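/- Conventions. An $n$-domain is an open subset of $\mathbb{R}^n$. For diffeological spaces, the D-open subsets are those whose preimage under every plot is open; subsets, products and quotients carry the subspace, product and quotient diffeologies. A map is étale if every point of its source has a D-open neighborhood which it maps diffeomorphically onto a D-open subset of the target. A smooth map $\pi:\mathcal E\to X$ is a diffeological étale map if for every plot $P:U\to X$ ($U$ a domain) the pullback $P^*\pi:\{(r,\xi)\in U\times\mathcal E \mid P(r)=\pi(\xi)\}\to U$, $(r,\xi)\mapsto r$, is étale. A diffeological covering map is a smooth surjection with discrete fibers whose pullbacks by all plots of the base are locally trivial with one common fiber type; its source is a diffeological covering space. An orbifold chart $(U,G,\varphi)$ of a diffeological space $X$ consists of a finite subgroup $G\subseteq \mathrm{GL}(n,\mathbb{R})$, a connected $G$-invariant $n$-domain $U$ (connected sets being nonempty), and a map $\varphi:U\to X$ which is the composite of the quotient map $U\to U/G$ with a diffeomorphism from $U/G$ onto a D-open subspace of $X$. A diffeological $n$-orbifold is a diffeological space in which every point lies in the image of such a chart. **Theorem.** Let $\mathcal O$ be a diffeological $n$-orbifold. 1. Let $\pi:\mathcal E\to\mathcal O$ be a diffeological étale map. Then $\mathcal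 E$ is a diffeological $n$-orbifold. Moreover, let $\xi\in\mathcal E$, let $(U,G,\varphi)$ be an orbifold chart of $\mathcal O$, and let $r_0\in U$ with $\varphi(r_0)=\pi(\xi)$. Then there are an open neighborhood $V\subseteq U$ of $r_0$ and a plot $L:V\to\mathcal E$ with $\pi\circ L=\varphi|_V$ and $L(r_0)=\xi$. For every such pair $(V,L)$ there is an open neighborhood $W\subseteq V$ of $r_0$ which is $G$-stable (that is, $W$ is connected and for each $g\in G$ either $g(W)=W$ or $g(W)\cap W=\varnothing$), such that $G_W:=\{g\in G\mid g(W)=W\}$ equals $G_{r_0}:=\{g\in G\mid g(r_0)=r_0\}$ and $(W,G_W,L|_W)$ is an orbifold chart of $\mathcal E$ (with $\xi=L(r_0)\in L(W)$). 2. If $\pi:\mathcal E\to\mathcal O$ is a diffeological covering map, then $\mathcal E$ is a diffeological $n$-orbifold. -/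

import Mathlib

open scoped Topology ContDiff Pointwise

namespace Diffeology

universe u v w

/-! ### Subspaces, products, quotients -/

/-- The pullback diffeology along `f : X → Y`: `p` is a plot iff `f ∘ p` is a plot of `Y`. -/
@[reducible]
def inducedDiffeology {X : Type u} {Y : Type v} [DiffeologicalSpace Y] (f : X → Y) :
    DiffeologicalSpace X where
  plots _ := {p | IsPlot (f ∘ p)}
  constant_plots _ := isPlot_const
  plot_reparam {_ _ p _} hp hf := isPlot_reparam (p := f ∘ p) hp hf
  locality {_ p} hp := DiffeologicalSpace.locality (p := f ∘ p) hp

/-- The subspace diffeology: the plots are the plots of `X` with values in the subset. -/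
instance instDiffeologicalSpaceSubtype {X : Type u} [DiffeologicalSpace X] (S : X → Prop) :
    DiffeologicalSpace (Subtype S) :=
  inducedDiffeology Subtype.val

/-- The product diffeology: `p` is a plot iff both of its components are plots. -/
instance instDiffeologicalSpaceProd {X : Type u} {Y : Type v}
    [DiffeologicalSpace X] [DiffeologicalSpace Y] : DiffeologicalSpace (X × Y) where
  plots _ := {p | IsPlot (Prod.fst ∘ p) ∧ IsPlot (Prod.snd ∘ p)}
  constant_plots _ := ⟨isPlot_const, isPlot_const⟩
  plot_reparam {_ _ p _} hp hf :=
    ⟨isPlot_reparam (p := Prod.fst ∘ p) hp.1 hf, isPlot_reparam (p := Prod.snd ∘ p) hp.2 hf⟩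
  locality {n p} hp := by
    refine ⟨DiffeologicalSpace.locality (p := Prod.fst ∘ p) fun x ↦ ?_,
      DiffeologicalSpace.locality (p := Prod.snd ∘ p) fun x ↦ ?_⟩
    · obtain ⟨s, hs, hx, h⟩ := hp x
      exact ⟨s, hs, hx, fun hf hf' ↦ (h hf hf').1⟩
    · obtain ⟨s, hs, hx, h⟩ := hp x
      exact ⟨s, hs, hx, fun hf hf' ↦ (h hf hf').2⟩

/-- The quotient diffeology: it is generated by the composites of the plots of `X` with the
quotient map. -/
instance instDiffeologicalSpaceQuotient {X : Type u} [DiffeologicalSpace X] (s : Setoid X) :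
    DiffeologicalSpace (Quotient s) :=
  DiffeologicalSpace.generateFrom
    {P | ∃ (m : ℕ) (p : EuclideanSpace ℝ (Fin m) → X), IsPlot p ∧ P = ⟨m, Quotient.mk s ∘ p⟩}

/-! ### D-open sets, diffeomorphisms, discrete spaces -/

/-- A subset is D-open if it is open in the D-topology. -/
def IsDOpen {X : Type u} [DiffeologicalSpace X] (S : Set X) : Prop :=
  IsOpen[dTopology] S

/-- Diffeomorphisms: bijections that are smooth in both directions. -/
structure DDiffeomorph (X : Type u) (Y : Type v) [DiffeologicalSpace X] [DiffeologicalSpace Y]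
    extends X ≃ Y where
  dSmooth_toFun : DSmooth toFun
  dSmooth_invFun : DSmooth invFun

/-- A diffeological space is discrete if its plots are locally constant. -/
def IsDiscreteDiffeology (X : Type u) [DiffeologicalSpace X] : Prop :=
  ∀ (n : ℕ) (p : EuclideanSpace ℝ (Fin n) → X), IsPlot p → IsLocallyConstant p

/-! ### Étale maps and diffeological étale maps

A plot of `X` with domain an open set `U` of `ℝⁿ` is a smooth map `U → X`, where `U` carries the
subspace diffeology. -/

/-- A map is étale if it restricts, near every point, to a diffeomorphism between D-open
subsets. -/
def IsEtale {X : Type u} {Y : Type v} [DiffeologicalSpace X] [DiffeologicalSpace Y]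
    (f : X → Y) : Prop :=
  ∀ x₀ : X, ∃ (A : Set X) (B : Set Y), IsDOpen A ∧ IsDOpen B ∧ x₀ ∈ A ∧
    ∃ e : DDiffeomorph A B, ∀ x : A, (e.toEquiv x : Y) = f x

/-- The total space `g^*X = {(z, x) | g z = f x} ⊆ Z × X` of the pullback of `f` by `g`, with the
subspace diffeology of the product. -/
abbrev PullbackSpace {X : Type u} {Y : Type v} {Z : Type w} (f : X → Y) (g : Z → Y) :
    Type (max u w) :=
  {q : Z × X // g q.1 = f q.2}

/-- The pullback `g^*f : g^*X → Z` of `f` by `g`. -/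
def pullbackMap {X : Type u} {Y : Type v} {Z : Type w} (f : X → Y) (g : Z → Y) :
    PullbackSpace f g → Z :=
  fun q ↦ q.1.1

/-- A smooth map is a diffeological étale map if its pullback by every plot is étale. -/
def IsDiffEtale {X : Type u} {Y : Type v} [DiffeologicalSpace X] [DiffeologicalSpace Y]
    (f : X → Y) : Prop :=
  DSmooth f ∧ ∀ (m : ℕ) (U : Set (EuclideanSpace ℝ (Fin m))), IsOpen U →
    ∀ P : U → Y, DSmooth P → IsEtale (pullbackMap f P)

/-! ### Fiber bundles and covering maps -/

/-- `f : X → Y` is locally trivial with fiber `T`: around every point of `Y` there is a D-open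
set `B` with `f ⁻¹(B)` diffeomorphic to `B × T` over `B`. -/
def IsLocallyTrivial (T : Type w) [DiffeologicalSpace T] {X : Type u} {Y : Type v}
    [DiffeologicalSpace X] [DiffeologicalSpace Y] (f : X → Y) : Prop :=
  ∀ y₀ : Y, ∃ B : Set Y, IsDOpen B ∧ y₀ ∈ B ∧
    ∃ e : DDiffeomorph (B × T) (f ⁻¹' B), ∀ z : B × T, f (e.toEquiv z) = z.1

/-- A diffeological fiber bundle of fiber type `T`: a smooth surjection whose pullback by every
plot of the base is locally trivial with fiber `T`. -/
def IsDiffFiberBundle (T : Type w) [DiffeologicalSpace T] {X : Type u} {Y : Type v}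
    [DiffeologicalSpace X] [DiffeologicalSpace Y] (f : X → Y) : Prop :=
  DSmooth f ∧ Function.Surjective f ∧
    ∀ (m : ℕ) (U : Set (EuclideanSpace ℝ (Fin m))), IsOpen U →
      ∀ P : U → Y, DSmooth P → IsLocallyTrivial T (pullbackMap f P)

/-- A diffeological covering map: a diffeological fiber bundle with discrete fibers. (If `Y` is
nonempty, the fiber type is diffeomorphic to a fiber of `f`, so the universe of `X` suffices
for it.) -/
def IsDiffCovering {X : Type u} {Y : Type v} [DiffeologicalSpace X] [DiffeologicalSpace Y]
    (f : X → Y) : Prop :=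
  (∃ (T : Type u) (_ : DiffeologicalSpace T), IsDiffFiberBundle T f) ∧
    ∀ y : Y, IsDiscreteDiffeology (f ⁻¹' {y})

/-! ### Orbifolds -/

/-- The general linear group of `ℝⁿ`, acting on `ℝⁿ` by evaluation. -/
abbrev GLn (n : ℕ) : Type := LinearMap.GeneralLinearGroup ℝ (EuclideanSpace ℝ (Fin n))

/-- Two points of `U` are related iff they lie in the same `G`-orbit. For `G`-invariant `U` the
quotient of `U` by this relation is `U / G`. -/
def orbitSetoid {n : ℕ} (U : Set (EuclideanSpace ℝ (Fin n))) (G : Subgroup (GLn n)) : Setoid U :=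
  (MulAction.orbitRel G (EuclideanSpace ℝ (Fin n))).comap Subtype.val

/-- `(U, G, φ)` is an orbifold chart of `X`: `G` is a finite subgroup of `GL(n, ℝ)`, `U` is a
connected `G`-invariant open subset of `ℝⁿ`, and `φ : U → X` is the composite of the quotient map
`U → U / G` and a diffeomorphism from `U / G` onto a D-open subspace `S` of `X`. -/
structure IsOrbifoldChart {n : ℕ} {X : Type u} [DiffeologicalSpace X]
    (U : Set (EuclideanSpace ℝ (Fin n))) (G : Subgroup (GLn n)) (φ : U → X) : Prop where
  isOpen : IsOpen U
  isConnected : IsConnected U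
  finite : Finite G
  invariant : ∀ g ∈ G, ∀ r ∈ U, g • r ∈ U
  exists_diffeomorph : ∃ S : Set X, IsDOpen S ∧
    ∃ e : DDiffeomorph (Quotient (orbitSetoid U G)) S,
      ∀ r : U, φ r = e.toEquiv (Quotient.mk (orbitSetoid U G) r)

/-- A diffeological `n`-orbifold: every point has a D-open neighborhood that is diffeomorphic to
some `U / G`, that is, every point lies in the image of an orbifold chart. -/
def IsDiffOrbifold (n : ℕ) (X : Type u) [DiffeologicalSpace X] : Prop :=
  ∀ x : X, ∃ (U : Set (EuclideanSpace ℝ (Fin n))) (G : Subgroup (GLn n)) (φ : U → X),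
    IsOrbifoldChart U G φ ∧ x ∈ Set.range φ

/-- `W` is `G`-stable: it is connected and every `g ∈ G` either preserves `W` or moves it off
itself. -/
def IsStableUnder {n : ℕ} (G : Subgroup (GLn n)) (W : Set (EuclideanSpace ℝ (Fin n))) : Prop :=
  IsConnected W ∧ ∀ g ∈ G, g • W = W ∨ Disjoint (g • W) W

/-- The subgroup `G_W = {g ∈ G | g(W) = W}`. -/
def setStabilizer {n : ℕ} (G : Subgroup (GLn n)) (W : Set (EuclideanSpace ℝ (Fin n))) :
    Subgroup (GLn n) :=
  G ⊓ MulAction.stabilizer (GLn n) W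

/-- The isotropy subgroup `G_r = {g ∈ G | g(r) = r}`. -/
def isotropy {n : ℕ} (G : Subgroup (GLn n)) (r : EuclideanSpace ℝ (Fin n)) : Subgroup (GLn n) :=
  G ⊓ MulAction.stabilizer (GLn n) r

/-- `L`, defined on `V`, is a local lift at `r₀` through `ξ` of `φ : U → Y` along `f : X → Y`:
`V` is an open neighborhood of `r₀` in `U`, and `L` is a plot with `f ∘ L = φ|_V` and
`L(r₀) = ξ`. -/
structure IsLocalLift {m : ℕ} {X : Type u} {Y : Type v} [DiffeologicalSpace X]
    (f : X → Y) {U : Set (EuclideanSpace ℝ (Fin m))} (φ : U → Y) (r₀ : U) (ξ : X)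
    (V : Set (EuclideanSpace ℝ (Fin m))) (L : V → X) : Prop where
  isOpen : IsOpen V
  subset : V ⊆ U
  dSmooth : DSmooth L
  lift : ∀ r : V, f (L r) = φ ⟨r, subset r.2⟩
  base : ∃ h : (r₀ : EuclideanSpace ℝ (Fin m)) ∈ V, L ⟨r₀, h⟩ = ξ

end Diffeology

open Diffeology

namespace Diffeology

universe u v w

/-! ### Smooth maps on open subsets and the D-topology -/

section OpenSubsets

variable {X : Type u} {Y : Type v} {Z : Type w} [DiffeologicalSpace X] [DiffeologicalSpace Y]
  [DiffeologicalSpace Z]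

/-! Two local lifting principles carry the proof. Along a diffeological étale map, lifts exist
locally with a prescribed value (`IsDiffEtale.exists_isLocalLift`), and lifts that agree at a point
agree near it (`IsDiffEtale.eventually_eq`). Through an orbifold chart, smooth maps also lift
locally with a prescribed value, since a lift through the quotient can be corrected by an element of
`G` (`IsOrbifoldChart.exists_lift`).

Let `L` lift the chart `φ`, with `L r₀ = ξ`. For `g` fixing `r₀`, both `L ∘ g` and `L` lift `φ` and
agree at `r₀`, hence near it. As `G` is finite, `L` is invariant under the isotropy group on a small
stable `W` (`exists_stable_neighborhood`). Conversely, `L r = L s` gives `φ r = φ s`, so some `g ∈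
G` carries `s` to `r`, and stability puts `g` in the stabilizer of `W`. Thus `L` induces an
injection of the quotient of `W` into the total space.

A plot meeting `L(W)` is projected to the base and lifted through `φ` into `W`; applying `L` gives
back the plot locally, by uniqueness. This makes `L(W)` D-open and the inverse smooth. A covering
map is étale because discreteness of the fiber type makes its sheets D-open. -/

theorem dSmooth_val (S : Set X) : DSmooth (Subtype.val : S → X) := fun _ _ hp ↦ hp

theorem DSmooth.codRestrict {f : X → Y} (hf : DSmooth f) {S : Set Y} (h : ∀ x, f x ∈ S) :
    DSmooth (S.codRestrict f h) := fun n p hp ↦ hf n p hp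

theorem dSmooth_inclusion {S T : Set X} (h : S ⊆ T) : DSmooth (Set.inclusion h) :=
  fun _ _ hp ↦ hp

theorem DSmooth.prodMk {f : X → Y} {g : X → Z} (hf : DSmooth f) (hg : DSmooth g) :
    DSmooth fun x ↦ (f x, g x) := fun n p hp ↦ ⟨hf n p hp, hg n p hp⟩

theorem dSmooth_fst : DSmooth (Prod.fst : X × Y → X) := fun _ _ hp ↦ hp.1

theorem dSmooth_snd : DSmooth (Prod.snd : X × Y → Y) := fun _ _ hp ↦ hp.2

theorem IsDOpen.preimage {f : X → Y} (hf : DSmooth f) {S : Set Y} (hS : IsDOpen S) :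
    IsDOpen (f ⁻¹' S) :=
  isOpen_iff_preimages_plots.2 fun n p hp ↦ isOpen_iff_preimages_plots.1 hS n _ (hf n p hp)

/-- The D-topology of `ℝᵐ` is its usual topology. -/
theorem isDOpen_iff_isOpen {m : ℕ} {S : Set (EuclideanSpace ℝ (Fin m))} :
    IsDOpen S ↔ IsOpen S := Iff.rfl

theorem _root_.ContDiffOn.dSmooth_restrict {m k : ℕ} {u : Set (EuclideanSpace ℝ (Fin m))}
    {g : EuclideanSpace ℝ (Fin m) → EuclideanSpace ℝ (Fin k)} (hg : ContDiffOn ℝ ∞ g u) :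
    DSmooth fun y : u ↦ g y := fun _ p hp ↦
  (hg.comp_contDiff (IsPlot.contDiff (p := Subtype.val ∘ p) hp) fun x ↦ (p x).2).isPlot

/-- Every point of an open subset of `ℝᵐ` is the centre of a global smooth parametrization of a
neighborhood of it, with smooth inverse. -/
theorem exists_ball_parametrization {m : ℕ} {u : Set (EuclideanSpace ℝ (Fin m))} (hu : IsOpen u)
    {x : EuclideanSpace ℝ (Fin m)} (hx : x ∈ u) :
    ∃ (f g : EuclideanSpace ℝ (Fin m) → EuclideanSpace ℝ (Fin m))
      (v : Set (EuclideanSpace ℝ (Fin m))), ContDiff ℝ ∞ f ∧ (∀ y, f y ∈ u) ∧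
      IsOpen v ∧ x ∈ v ∧ v ⊆ u ∧ ContDiffOn ℝ ∞ g v ∧ (∀ y ∈ v, f (g y) = y) ∧ g x = 0 := by
  obtain ⟨ε, hε, hεu⟩ := Metric.isOpen_iff.1 hu x hx
  refine ⟨OpenPartialHomeomorph.univBall x ε, (OpenPartialHomeomorph.univBall x ε).symm,
    Metric.ball x ε, OpenPartialHomeomorph.contDiff_univBall, fun y ↦ hεu ?_,
    Metric.isOpen_ball, Metric.mem_ball_self hε,
    hεu, OpenPartialHomeomorph.contDiffOn_univBall_symm, fun y hy ↦ ?_,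
    OpenPartialHomeomorph.univBall_symm_apply_center x ε⟩
  · rw [← OpenPartialHomeomorph.univBall_target x hε]
    exact (OpenPartialHomeomorph.univBall x ε).map_source (by simp)
  · exact (OpenPartialHomeomorph.univBall x ε).right_inv
      (by rwa [OpenPartialHomeomorph.univBall_target x hε])

theorem isPlot_codRestrict {m k : ℕ} {u : Set (EuclideanSpace ℝ (Fin m))}
    {f : EuclideanSpace ℝ (Fin k) → EuclideanSpace ℝ (Fin m)} (hf : ContDiff ℝ ∞ f)
    (h : ∀ y, f y ∈ u) : IsPlot (u.codRestrict f h) := hf.isPlot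

/-- Smooth maps on open subsets of `ℝᵐ` are continuous for the D-topology. -/
theorem IsDOpen.isOpen_image_preimage {m : ℕ} {u : Set (EuclideanSpace ℝ (Fin m))}
    (hu : IsOpen u) {P : u → X} (hP : DSmooth P) {S : Set X} (hS : IsDOpen S) :
    IsOpen (Subtype.val '' (P ⁻¹' S)) := by
  rw [isOpen_iff_mem_nhds]
  rintro _ ⟨⟨x, hx⟩, hxS, rfl⟩
  obtain ⟨f, g, v, hf, hfu, hv, hxv, hvu, hg, hfg, hgx⟩ := exists_ball_parametrization hu hx
  have h1 : IsOpen ((P ∘ u.codRestrict f hfu) ⁻¹' S) :=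
    isOpen_iff_preimages_plots.1 hS _ _ (hP _ _ (isPlot_codRestrict hf hfu))
  refine Filter.mem_of_superset ((hg.continuousOn.isOpen_inter_preimage hv h1).mem_nhds
    ⟨hxv, ?_⟩) ?_
  · have : u.codRestrict f hfu (g x) = ⟨x, hx⟩ := Subtype.ext (hfg x hxv)
    simpa [this] using hxS
  · rintro y ⟨hyv, hy⟩
    refine ⟨⟨y, hvu hyv⟩, ?_, rfl⟩
    have : u.codRestrict f hfu (g y) = ⟨y, hvu hyv⟩ := Subtype.ext (hfg y hyv)
    simpa [this] using hy

theorem IsDOpen.isOpen_image_val {m : ℕ} {u : Set (EuclideanSpace ℝ (Fin m))}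
    (hu : IsOpen u) {S : Set u} (hS : IsDOpen S) : IsOpen (Subtype.val '' S) :=
  hS.isOpen_image_preimage hu dSmooth_id

/-- A plot of `X` restricts to a smooth map into `S` on the preimage of `S`, which is open because
`S` is D-open. -/
theorem IsDOpen.image_val {S : Set X} (hS : IsDOpen S) {A : Set S} (hA : IsDOpen A) :
    IsDOpen (Subtype.val '' A) := by
  refine isOpen_iff_preimages_plots.2 fun n p hp ↦ ?_
  have hu : IsOpen (p ⁻¹' S) := isOpen_iff_preimages_plots.1 hS n p hp
  have hP : DSmooth (fun y : p ⁻¹' S ↦ (⟨p y, y.2⟩ : S)) :=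
    (hp.dSmooth.comp (dSmooth_val _)).codRestrict (S := S) fun y ↦ y.2
  convert hA.isOpen_image_preimage hu hP using 1
  ext y
  constructor
  · rintro ⟨a, ha, hay⟩
    exact ⟨⟨y, by rw [Set.mem_preimage, ← hay]; exact a.2⟩, by
      rw [Set.mem_preimage]; convert ha; exact hay.symm, rfl⟩
  · rintro ⟨y, hy, rfl⟩
    exact ⟨_, hy, rfl⟩

/-- A map which is locally smooth is a plot. -/
theorem isPlot_of_locally {m : ℕ} {p : EuclideanSpace ℝ (Fin m) → X}
    (h : ∀ x, ∃ u : Set (EuclideanSpace ℝ (Fin m)), IsOpen u ∧ x ∈ u ∧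
      DSmooth fun y : u ↦ p y) : IsPlot p :=
  DiffeologicalSpace.locality fun x ↦ by
    obtain ⟨u, hu, hx, hp⟩ := h x
    exact ⟨u, hu, hx, fun hf hf' ↦ hp _ _ (isPlot_codRestrict hf' hf)⟩

end OpenSubsets

/-! ### Quotient diffeologies and local lifts -/

section Quotient

variable {X : Type u} [DiffeologicalSpace X] (s : Setoid X)

theorem dSmooth_quotientMk : DSmooth (Quotient.mk s) := fun _ p hp ↦
  DiffeologicalSpace.isPlot_generatedFrom_of_mem ⟨_, p, hp, rfl⟩

/-- By minimality of the generated diffeology, it suffices that the generators are plots of the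
diffeology pulled back along the induced map. -/
theorem DSmooth.quotientLift {Y : Type v} [DiffeologicalSpace Y] {s : Setoid X} {f : X → Y}
    (hf : DSmooth f) (h : ∀ a b, s a b → f a = f b) : DSmooth (Quotient.lift f h) := by
  have hle := (DiffeologicalSpace.generateFrom_le_iff (g := {P | ∃ (m : ℕ)
    (p : EuclideanSpace ℝ (Fin m) → X), IsPlot p ∧ P = ⟨m, Quotient.mk s ∘ p⟩})
    (d := inducedDiffeology (Quotient.lift f h))).2 (by
      rintro n p ⟨m, q, hq, heq⟩
      cases heq
      exact hf _ _ hq)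
  exact fun n p hp ↦ DiffeologicalSpace.le_iff'.1 hle n p hp

/-- The maps from `ℝᵐ` to a quotient which locally lift to smooth maps. -/
def LiftsLocally {m : ℕ} (p : EuclideanSpace ℝ (Fin m) → Quotient s) : Prop :=
  ∀ x, ∃ u : Set (EuclideanSpace ℝ (Fin m)), IsOpen u ∧ x ∈ u ∧ ∃ q : u → X, DSmooth q ∧
    ∀ y : u, p y = Quotient.mk s (q y)

variable {s}

/-- Plots live on all of `ℝᵐ`, whereas `P` is controlled only on `u`: a global parametrization of a
ball around `x` yields a lift near `0`, which its inverse carries back to `x`. -/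
theorem exists_lift_of_liftsLocally {m : ℕ} {u : Set (EuclideanSpace ℝ (Fin m))} (hu : IsOpen u)
    (P : EuclideanSpace ℝ (Fin m) → Quotient s)
    (h : ∀ f : EuclideanSpace ℝ (Fin m) → EuclideanSpace ℝ (Fin m), ContDiff ℝ ∞ f →
      (∀ y, f y ∈ u) → LiftsLocally s (P ∘ f))
    {x : EuclideanSpace ℝ (Fin m)} (hx : x ∈ u) :
    ∃ v : Set (EuclideanSpace ℝ (Fin m)), IsOpen v ∧ x ∈ v ∧ v ⊆ u ∧ ∃ q : v → X, DSmooth q ∧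
      ∀ y : v, P y = Quotient.mk s (q y) := by
  obtain ⟨f, g, v, hf, hfu, hv, hxv, hvu, hg, hfg, hgx⟩ := exists_ball_parametrization hu hx
  obtain ⟨u', hu', h0, q, hq, hpq⟩ := h f hf hfu 0
  refine ⟨v ∩ g ⁻¹' u', hg.continuousOn.isOpen_inter_preimage hv hu', ⟨hxv, by
    rwa [Set.mem_preimage, hgx]⟩, Set.inter_subset_left.trans hvu, fun y ↦ q ⟨g y, y.2.2⟩,
    hq.comp ((hg.mono Set.inter_subset_left).dSmooth_restrict.codRestrict fun y ↦ y.2.2),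
    fun y ↦ ?_⟩
  rw [← hpq ⟨g y, y.2.2⟩, Function.comp_apply, hfg y y.2.1]

variable (s) in
/-- The diffeology of locally liftable maps into a quotient. -/
@[reducible]
def liftDiffeology : DiffeologicalSpace (Quotient s) where
  plots m := {p | LiftsLocally s p}
  constant_plots {m} a := fun x ↦ by
    obtain ⟨a, rfl⟩ := Quotient.exists_rep a
    exact ⟨Set.univ, isOpen_univ, trivial, fun _ ↦ a, dSmooth_const, fun _ ↦ rfl⟩
  plot_reparam {n m p f} hp hf := fun x ↦ by
    obtain ⟨u, hu, hx, q, hq, hpq⟩ := hp (f x)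
    exact ⟨f ⁻¹' u, hu.preimage hf.continuous, hx, fun y ↦ q ⟨f y, y.2⟩,
      hq.comp (hf.contDiffOn.dSmooth_restrict.codRestrict fun y ↦ y.2), fun y ↦ hpq ⟨f y, y.2⟩⟩
  locality {m p} hp := fun x ↦ by
    obtain ⟨u, hu, hx, h⟩ := hp x
    obtain ⟨v, hv, hxv, -, hq⟩ :=
      exists_lift_of_liftsLocally hu p (fun f hf hfu ↦ h hfu hf) hx
    exact ⟨v, hv, hxv, hq⟩

/-- The locally liftable maps form a diffeology containing the generators, and the quotient
diffeology is the smallest such. -/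
theorem IsPlot.liftsLocally {m : ℕ} {p : EuclideanSpace ℝ (Fin m) → Quotient s} (hp : IsPlot p) :
    LiftsLocally s p := by
  have hle := (DiffeologicalSpace.generateFrom_le_iff (g := {P | ∃ (m : ℕ)
    (p : EuclideanSpace ℝ (Fin m) → X), IsPlot p ∧ P = ⟨m, Quotient.mk s ∘ p⟩})
    (d := liftDiffeology s)).2 (by
      rintro n p ⟨m, q, hq, heq⟩
      cases heq
      exact fun x ↦ ⟨Set.univ, isOpen_univ, trivial, fun y ↦ q y,
        hq.dSmooth.comp (dSmooth_val _), fun _ ↦ rfl⟩)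
  exact DiffeologicalSpace.le_iff'.1 hle m p hp

/-- Smooth maps from an open subset of `ℝᵐ` to a quotient lift locally. -/
theorem DSmooth.exists_lift {m : ℕ} {u : Set (EuclideanSpace ℝ (Fin m))} (hu : IsOpen u)
    {P : u → Quotient s} (hP : DSmooth P) (x : u) :
    ∃ (v : Set (EuclideanSpace ℝ (Fin m))) (hvu : v ⊆ u), IsOpen v ∧ (x : EuclideanSpace ℝ (Fin m)) ∈ v ∧
      ∃ q : v → X, DSmooth q ∧ ∀ y, P (Set.inclusion hvu y) = Quotient.mk s (q y) := by
  classical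
  -- The value off `u` is immaterial: only parametrizations with values in `u` are composed with
  -- `P'`.
  let P' : EuclideanSpace ℝ (Fin m) → Quotient s := fun y ↦ if hy : y ∈ u then P ⟨y, hy⟩ else P x
  have hP' : ∀ y (hy : y ∈ u), P' y = P ⟨y, hy⟩ := fun y hy ↦ dif_pos hy
  obtain ⟨v, hv, hxv, hvu, q, hq, h⟩ := exists_lift_of_liftsLocally hu P' (fun f hf hfu ↦ by
    have : P' ∘ f = P ∘ u.codRestrict f hfu := funext fun y ↦ hP' _ (hfu y)
    rw [this]
    exact (hP _ _ (isPlot_codRestrict hf hfu)).liftsLocally) x.2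
  exact ⟨v, hvu, hv, hxv, q, hq, fun y ↦ (hP' y (hvu y.2)).symm.trans (h y)⟩

end Quotient

/-! ### Étale maps, lifts and coverings -/

section Etale

variable {X : Type u} {Y : Type v} [DiffeologicalSpace X]

/-- The section of the pullback of `f` by `P` defined by a lift `L` of `P` along `f`. -/
def pullbackSection {Z : Type w} {f : X → Y} {P : Z → Y} (L : Z → X) (h : ∀ z, P z = f (L z))
    (z : Z) : PullbackSpace f P :=
  ⟨(z, L z), h z⟩

theorem dSmooth_pullbackSection {Z : Type w} [DiffeologicalSpace Z] {f : X → Y} {P : Z → Y}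
    {L : Z → X} (hL : DSmooth L) (h : ∀ z, P z = f (L z)) : DSmooth (pullbackSection L h) :=
  fun n p hp ↦ (dSmooth_id.prodMk hL) n p hp

/-- The fiber type of a locally trivial pullback of a map with discrete fibers is discrete. -/
theorem IsLocallyTrivial.isDiscreteDiffeology_fiberType {T : Type w} [DiffeologicalSpace T]
    {f : X → Y} (hf : ∀ y : Y, IsDiscreteDiffeology (f ⁻¹' {y})) {Z : Type*} [DiffeologicalSpace Z]
    {P : Z → Y} (h : IsLocallyTrivial T (pullbackMap f P)) (z : Z) : IsDiscreteDiffeology T := by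
  intro n p hp
  obtain ⟨B, hB, hz, e, he⟩ := h z
  have hfst : ∀ t : T, (e.toEquiv (⟨z, hz⟩, t)).1.1.1 = z := fun t ↦ he (⟨z, hz⟩, t)
  -- Freezing the base point in the trivialization gives a smooth injection of `T` into a discrete
  -- fiber; injectivity pulls local constancy of plots back to `T`.
  let ι : T → f ⁻¹' {P z} := fun t ↦ ⟨(e.toEquiv (⟨z, hz⟩, t)).1.1.2, by
    have := (e.toEquiv (⟨z, hz⟩, t)).1.2
    rw [hfst] at this
    exact this.symm⟩
  have h1 : DSmooth fun t ↦ (e.toEquiv (⟨z, hz⟩, t)).1.1.2 :=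
    ((dSmooth_snd.comp (dSmooth_val _)).comp (dSmooth_val _)).comp
      (e.dSmooth_toFun.comp (dSmooth_const.prodMk dSmooth_id))
  have hι : DSmooth ι := h1.codRestrict _
  have hinj : Function.Injective ι := fun t t' htt' ↦ by
    have h2 : e.toEquiv (⟨z, hz⟩, t) = e.toEquiv (⟨z, hz⟩, t') :=
      Subtype.ext (Subtype.ext
        (Prod.ext ((hfst t).trans (hfst t').symm) (congrArg Subtype.val htt')))
    exact congrArg Prod.snd (e.toEquiv.injective h2)
  rw [IsLocallyConstant.iff_eventually_eq]
  intro x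
  filter_upwards [(IsLocallyConstant.iff_eventually_eq _).1 (hf _ n _ (hι n p hp)) x] with y hy
  exact hinj hy

variable [DiffeologicalSpace Y]

/-- Lifts along a diffeological étale map which agree at a point agree near it. -/
theorem IsDiffEtale.eventually_eq {f : X → Y} (hf : IsDiffEtale f) {m : ℕ}
    {u : Set (EuclideanSpace ℝ (Fin m))} (hu : IsOpen u) {p q : u → X} (hp : DSmooth p)
    (hq : DSmooth q) (hpq : ∀ y, f (p y) = f (q y)) {x : u} (hx : p x = q x) :
    ∃ v : Set (EuclideanSpace ℝ (Fin m)), IsOpen v ∧ (x : EuclideanSpace ℝ (Fin m)) ∈ v ∧ v ⊆ u ∧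
      ∀ y : u, (y : EuclideanSpace ℝ (Fin m)) ∈ v → p y = q y := by
  -- Both `p` and `q` give sections of the pullback by `f ∘ p`, with the same value at `x`. Near `x`
  -- both stay in `A`, where the projection is injective.
  obtain ⟨A, B, hA, hB, hxA, e, he⟩ := hf.2 m u hu (f ∘ p) (hf.1.comp hp)
    (pullbackSection p (fun _ ↦ rfl) x)
  have h1 := hA.isOpen_image_preimage hu (dSmooth_pullbackSection (f := f) hp fun _ ↦ rfl)
  have h2 := hA.isOpen_image_preimage hu (dSmooth_pullbackSection hq hpq)
  refine ⟨_, h1.inter h2, ⟨⟨x, hxA, rfl⟩, ⟨x, ?_, rfl⟩⟩, fun y hy ↦ ?_, fun y hy ↦ ?_⟩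
  · have : pullbackSection q hpq x = pullbackSection p (fun _ ↦ rfl) x :=
      Subtype.ext (Prod.ext rfl hx.symm)
    rwa [Set.mem_preimage, this]
  · obtain ⟨⟨z, -, rfl⟩, -⟩ := hy
    exact z.2
  · obtain ⟨⟨z, hz, hzy⟩, ⟨z', hz', hzy'⟩⟩ := hy
    obtain rfl := Subtype.ext hzy
    obtain rfl := Subtype.ext hzy'
    have h3 : e.toEquiv ⟨_, hz⟩ = e.toEquiv ⟨_, hz'⟩ := by
      apply Subtype.ext
      rw [he, he]
      rfl
    exact congrArg (fun a : A ↦ a.1.1.2) (e.toEquiv.injective h3)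

/-- Smooth maps from open subsets of `ℝᵐ` lift locally along diffeological étale maps. -/
theorem IsDiffEtale.exists_isLocalLift {f : X → Y} (hf : IsDiffEtale f) {m : ℕ}
    {U : Set (EuclideanSpace ℝ (Fin m))} (hU : IsOpen U) {φ : U → Y} (hφ : DSmooth φ) {r₀ : U}
    {ξ : X} (h : φ r₀ = f ξ) :
    ∃ (V : Set (EuclideanSpace ℝ (Fin m))) (L : V → X), IsLocalLift f φ r₀ ξ V L := by
  -- The lift is the local inverse of the pullback at `(r₀, ξ)`, followed by the projection to `X`.
  obtain ⟨A, B, hA, hB, hxA, e, he⟩ := hf.2 m U hU φ hφ ⟨(r₀, ξ), h⟩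
  have hVU : Subtype.val '' B ⊆ U := by rintro _ ⟨y, -, rfl⟩; exact y.2
  have hmem : ∀ r : (Subtype.val '' B : Set (EuclideanSpace ℝ (Fin m))),
      (⟨r, hVU r.2⟩ : U) ∈ B := by
    rintro ⟨_, y, hy, rfl⟩
    exact hy
  have hfst : ∀ b : B, ((e.toEquiv.symm b).1.1.1 : U) = b := fun b ↦ by
    have := he (e.toEquiv.symm b)
    rw [Equiv.apply_symm_apply] at this
    exact this.symm
  have hr₀ : e.toEquiv ⟨⟨(r₀, ξ), h⟩, hxA⟩ = ⟨r₀, by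
      rw [show r₀ = _ from (he ⟨⟨(r₀, ξ), h⟩, hxA⟩).symm]; exact Subtype.prop _⟩ :=
    Subtype.ext (he _)
  refine ⟨Subtype.val '' B, fun r ↦ (e.toEquiv.symm ⟨⟨r, hVU r.2⟩, hmem r⟩).1.1.2,
    hB.isOpen_image_val hU, hVU, ?_, fun r ↦ ?_, ⟨⟨r₀, ?_, rfl⟩, ?_⟩⟩
  · have h1 : DSmooth fun r : (Subtype.val '' B : Set (EuclideanSpace ℝ (Fin m))) ↦
        (⟨⟨r, hVU r.2⟩, hmem r⟩ : B) := fun _ _ hp ↦ hp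
    have h2 : DSmooth fun a : A ↦ a.1.1.2 := fun n p hp ↦ IsPlot.dSmooth_comp hp
      ((dSmooth_snd.comp (dSmooth_val _)).comp (dSmooth_val _))
    exact h2.comp (e.dSmooth_invFun.comp h1)
  · rw [← (e.toEquiv.symm ⟨⟨r, hVU r.2⟩, hmem r⟩).1.2, hfst]
  · have := (e.toEquiv ⟨⟨(r₀, ξ), h⟩, hxA⟩).2
    rwa [he] at this
  · change (e.toEquiv.symm ⟨r₀, _⟩).1.1.2 = ξ
    rw [← hr₀, Equiv.symm_apply_apply]

theorem IsDiscreteDiffeology.isDOpen {T : Type w} [DiffeologicalSpace T]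
    (h : IsDiscreteDiffeology T) (S : Set T) : IsDOpen S :=
  isOpen_iff_preimages_plots.2 fun n p hp ↦ h n p hp S

/-- Points of a discrete `T` are D-open, so the sheet `B × {t}` through the given point is D-open
and projects diffeomorphically onto `B`. -/
theorem IsLocallyTrivial.isEtale {T : Type w} [DiffeologicalSpace T]
    (hT : IsDiscreteDiffeology T) {f : X → Y} (hfs : DSmooth f) (hf : IsLocallyTrivial T f) :
    IsEtale f := by
  intro x
  obtain ⟨B, hB, hx, e, he⟩ := hf (f x)
  let t : T := (e.toEquiv.symm ⟨x, hx⟩).2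
  let A' : Set (f ⁻¹' B) := (fun a ↦ (e.toEquiv.symm a).2) ⁻¹' {t}
  have hA' : IsDOpen A' :=
    (hT.isDOpen {t}).preimage (dSmooth_snd.comp e.dSmooth_invFun)
  have hA : IsDOpen (Subtype.val '' A' : Set X) := (hB.preimage hfs).image_val hA'
  have hmem : ∀ a : (Subtype.val '' A' : Set X), ∃ h : (a : X) ∈ f ⁻¹' B,
      (e.toEquiv.symm ⟨a, h⟩).2 = t := by
    rintro ⟨_, a, ha, rfl⟩
    exact ⟨a.2, ha⟩
  have hsymm : ∀ a, ((e.toEquiv.symm a).1 : Y) = f a := fun a ↦ by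
    rw [← he, Equiv.apply_symm_apply]
  refine ⟨Subtype.val '' A', B, hA, hB, ⟨⟨x, hx⟩, rfl, rfl⟩, ⟨
    { toFun := fun a ↦ ⟨f a, (hmem a).1⟩
      invFun := fun b ↦ ⟨e.toEquiv (b, t), e.toEquiv (b, t), by simp [A'], rfl⟩
      left_inv := fun a ↦ Subtype.ext ?_
      right_inv := fun b ↦ Subtype.ext (he (b, t)) }, ?_, ?_⟩, fun a ↦ rfl⟩
  · have h1 : ((⟨f a, (hmem a).1⟩ : B), t) = e.toEquiv.symm ⟨a, (hmem a).1⟩ :=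
      Prod.ext (Subtype.ext (hsymm ⟨a, (hmem a).1⟩).symm) (hmem a).2.symm
    change ((e.toEquiv (⟨f a, (hmem a).1⟩, t) : f ⁻¹' B) : X) = a
    rw [h1, Equiv.apply_symm_apply]
  · exact (hfs.comp (dSmooth_val _)).codRestrict _
  · exact ((dSmooth_val _).comp (e.dSmooth_toFun.comp
      (dSmooth_id.prodMk dSmooth_const))).codRestrict _

/-- Diffeological covering maps are diffeological étale maps. -/
theorem IsDiffCovering.isDiffEtale {f : X → Y} (hf : IsDiffCovering f) : IsDiffEtale f := by
  obtain ⟨⟨T, _, hsm, -, htriv⟩, hdisc⟩ := hf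
  refine ⟨hsm, fun m U hU P hP z ↦ ?_⟩
  have h := htriv m U hU P hP
  -- The base point of `z` matters: over an empty domain local triviality says nothing about `T`.
  exact h.isEtale (h.isDiscreteDiffeology_fiberType hdisc z.1.1)
    (dSmooth_fst.comp (dSmooth_val _)) z

end Etale

/-! ### Orbifold charts, stable neighborhoods and lifted charts -/

section Chart

variable {n : ℕ} {X : Type u} {Y : Type v} [DiffeologicalSpace X] [DiffeologicalSpace Y]

theorem orbitSetoid_apply {U : Set (EuclideanSpace ℝ (Fin n))} {G : Subgroup (GLn n)} {r s : U} :
    orbitSetoid U G r s ↔ ∃ g ∈ G, g • (s : EuclideanSpace ℝ (Fin n)) = r := by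
  change (r : EuclideanSpace ℝ (Fin n)) ∈ MulAction.orbit G (s : EuclideanSpace ℝ (Fin n)) ↔ _
  simp [MulAction.mem_orbit_iff, Subgroup.smul_def]

theorem contDiff_GLn_smul (g : GLn n) :
    ContDiff ℝ ∞ fun r : EuclideanSpace ℝ (Fin n) ↦ g • r :=
  (LinearMap.toContinuousLinearMap
    (g : EuclideanSpace ℝ (Fin n) →ₗ[ℝ] EuclideanSpace ℝ (Fin n))).contDiff

theorem isOpen_GLn_smul (g : GLn n) {W : Set (EuclideanSpace ℝ (Fin n))} (hW : IsOpen W) :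
    IsOpen (g • W) := by
  rw [← Set.preimage_smul_inv]
  exact hW.preimage (contDiff_GLn_smul g⁻¹).continuous

namespace IsOrbifoldChart

variable {U : Set (EuclideanSpace ℝ (Fin n))} {G : Subgroup (GLn n)} {φ : U → Y}

theorem dSmooth (h : IsOrbifoldChart U G φ) : DSmooth φ := by
  obtain ⟨S, hS, e, he⟩ := h.exists_diffeomorph
  rw [show φ = fun r ↦ (e.toEquiv (Quotient.mk _ r) : Y) from funext he]
  exact (dSmooth_val S).comp (e.dSmooth_toFun.comp (dSmooth_quotientMk _))

theorem apply_eq_iff (h : IsOrbifoldChart U G φ) {r s : U} :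
    φ r = φ s ↔ ∃ g ∈ G, g • (s : EuclideanSpace ℝ (Fin n)) = r := by
  obtain ⟨S, hS, e, he⟩ := h.exists_diffeomorph
  rw [he, he, Subtype.val_inj, e.toEquiv.apply_eq_iff_eq, ← orbitSetoid_apply]
  exact Quotient.eq

/-- Smooth maps into the base lift locally through an orbifold chart, with prescribed value at
one point. -/
theorem exists_lift (h : IsOrbifoldChart U G φ) {m : ℕ} {u : Set (EuclideanSpace ℝ (Fin m))}
    (hu : IsOpen u) {P : u → Y} (hP : DSmooth P) {x : u} {w : U} (hx : P x = φ w) :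
    ∃ (v : Set (EuclideanSpace ℝ (Fin m))) (hvu : v ⊆ u) (hxv : (x : EuclideanSpace ℝ (Fin m)) ∈ v), IsOpen v ∧
      ∃ q : v → U, DSmooth q ∧ q ⟨x, hxv⟩ = w ∧ ∀ y, φ (q y) = P (Set.inclusion hvu y) := by
  obtain ⟨S, hS, e, he⟩ := h.exists_diffeomorph
  set u₁ : Set (EuclideanSpace ℝ (Fin m)) := Subtype.val '' (P ⁻¹' S) with hu₁_def
  have hu₁ : IsOpen u₁ := hS.isOpen_image_preimage hu hP
  have hu₁u : u₁ ⊆ u := by rintro _ ⟨y, -, rfl⟩; exact y.2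
  have hmem : ∀ y : u₁, P (Set.inclusion hu₁u y) ∈ S := by
    rintro ⟨_, y, hy, rfl⟩
    exact hy
  have hxu₁ : (x : EuclideanSpace ℝ (Fin m)) ∈ u₁ :=
    ⟨x, by rw [Set.mem_preimage, hx, he]; exact Subtype.prop _, rfl⟩
  have hQ : DSmooth fun y : u₁ ↦ e.toEquiv.symm ⟨P (Set.inclusion hu₁u y), hmem y⟩ :=
    e.dSmooth_invFun.comp ((hP.comp (dSmooth_inclusion hu₁u)).codRestrict hmem)
  obtain ⟨v, hvu, hv, hxv, q, hq, hPq⟩ := hQ.exists_lift hu₁ ⟨x, hxu₁⟩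
  have hφq : ∀ y, φ (q y) = P (Set.inclusion (hvu.trans hu₁u) y) := fun y ↦ by
    rw [he, ← hPq, Equiv.apply_symm_apply]
  -- The lift `q` at `x` and `w` have the same image under `φ`, so some `g ∈ G` moves one to the
  -- other; `g • q` is then the corrected lift.
  obtain ⟨g, hg, hgw⟩ := h.apply_eq_iff.1 (hx.symm.trans (hφq ⟨x, hxv⟩).symm)
  refine ⟨v, hvu.trans hu₁u, hxv, hv, fun y ↦ ⟨g • (q y : EuclideanSpace ℝ (Fin n)),
    h.invariant g hg _ (q y).2⟩, ?_, Subtype.ext hgw, fun y ↦ ?_⟩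
  · exact ((contDiff_GLn_smul g).dSmooth.comp ((dSmooth_val U).comp hq)).codRestrict _
  · rw [← hφq y]
    exact h.apply_eq_iff.2 ⟨g, hg, rfl⟩

end IsOrbifoldChart

theorem setStabilizer_eq_isotropy {G : Subgroup (GLn n)} {W : Set (EuclideanSpace ℝ (Fin n))}
    {r₀ : EuclideanSpace ℝ (Fin n)} (hr₀ : r₀ ∈ W) (h₁ : ∀ g ∈ isotropy G r₀, g • W = W)
    (h₂ : ∀ g ∈ G, g • r₀ ≠ r₀ → Disjoint (g • W) W) : setStabilizer G W = isotropy G r₀ := by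
  refine le_antisymm (fun g hg ↦ ⟨hg.1, ?_⟩) fun g hg ↦ ⟨hg.1, h₁ g hg⟩
  by_contra hne
  have hgW : g • W = W := hg.2
  have := h₂ g hg.1 hne
  rw [hgW] at this
  exact Set.disjoint_left.1 this hr₀ hr₀

/-- Every point has arbitrarily small `G`-stable open neighborhoods whose stabilizer is the
isotropy group of the point. -/
theorem exists_stable_neighborhood (G : Subgroup (GLn n)) [Finite G]
    (r₀ : EuclideanSpace ℝ (Fin n)) {N : Set (EuclideanSpace ℝ (Fin n))} (hN : N ∈ 𝓝 r₀) :
    ∃ W ⊆ N, r₀ ∈ W ∧ IsOpen W ∧ IsStableUnder G W ∧ setStabilizer G W = isotropy G r₀ := by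
  have hsep : ∀ g : G, ∃ D ∈ 𝓝 r₀, (g : GLn n) • r₀ ≠ r₀ → Disjoint ((g : GLn n) • D) D := by
    intro g
    by_cases hg : (g : GLn n) • r₀ = r₀
    · exact ⟨Set.univ, Filter.univ_mem, fun h ↦ absurd hg h⟩
    obtain ⟨A, B, hA, hB, hrA, hrB, hAB⟩ := t2_separation hg
    refine ⟨B ∩ (fun r ↦ (g : GLn n) • r) ⁻¹' A, Filter.inter_mem (hB.mem_nhds hrB)
      ((hA.preimage (contDiff_GLn_smul _).continuous).mem_nhds hrA), fun _ ↦ ?_⟩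
    refine hAB.mono ?_ Set.inter_subset_left
    rintro _ ⟨r, hr, rfl⟩
    exact hr.2
  choose D hD hDdisj using hsep
  obtain ⟨ε, hε, hball⟩ := Metric.mem_nhds_iff.1
    (Filter.inter_mem hN (Filter.iInter_mem.2 hD))
  have hfin : Finite (isotropy G r₀) :=
    Finite.of_injective (Subgroup.inclusion (inf_le_left : isotropy G r₀ ≤ G))
      (Subgroup.inclusion_injective _)
  -- A ball need not be invariant, since `G` need not be orthogonal. Intersecting its isotropy
  -- translates makes it so; linearity keeps the intersection convex, and finiteness keeps it open.
  set W : Set (EuclideanSpace ℝ (Fin n)) :=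
    ⋂ g : isotropy G r₀, (g : GLn n) • Metric.ball r₀ ε with hW_def
  have hWball : W ⊆ Metric.ball r₀ ε := by
    refine (Set.iInter_subset _ (1 : isotropy G r₀)).trans ?_
    simp
  have hrW : r₀ ∈ W := Set.mem_iInter.2 fun g ↦
    ⟨r₀, Metric.mem_ball_self hε, g.2.2⟩
  have hWopen : IsOpen W := isOpen_iInter_of_finite fun g ↦ isOpen_GLn_smul _ Metric.isOpen_ball
  have hWconv : Convex ℝ W := convex_iInter fun g ↦
    (convex_ball r₀ ε).linear_image
      ((g : GLn n) : EuclideanSpace ℝ (Fin n) →ₗ[ℝ] EuclideanSpace ℝ (Fin n))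
  have hle : ∀ g ∈ isotropy G r₀, g • W ⊆ W := by
    rintro g hg _ ⟨r, hr, rfl⟩
    refine Set.mem_iInter.2 fun k ↦ ?_
    obtain ⟨b, hb, hbr⟩ := Set.mem_iInter.1 hr (⟨g, hg⟩⁻¹ * k)
    refine ⟨b, hb, ?_⟩
    have hbr' : (g⁻¹ * (k : GLn n)) • b = r := hbr
    change (k : GLn n) • b = g • r
    rw [← hbr', smul_smul, mul_inv_cancel_left]
  have h₁ : ∀ g ∈ isotropy G r₀, g • W = W := fun g hg ↦
    (hle g hg).antisymm (Set.subset_smul_set_iff.2 (hle g⁻¹ (inv_mem hg)))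
  have h₂ : ∀ g ∈ G, g • r₀ ≠ r₀ → Disjoint (g • W) W := fun g hg hne ↦ by
    have hWD : W ⊆ D ⟨g, hg⟩ := fun r hr ↦ Set.mem_iInter.1 (hball (hWball hr)).2 ⟨g, hg⟩
    exact (hDdisj ⟨g, hg⟩ hne).mono (Set.smul_set_mono hWD) hWD
  refine ⟨W, fun r hr ↦ (hball (hWball hr)).1, hrW, hWopen, ⟨⟨⟨r₀, hrW⟩, hWconv.isPreconnected⟩,
    fun g hg ↦ ?_⟩, setStabilizer_eq_isotropy hrW h₁ h₂⟩
  by_cases hgr : g • r₀ = r₀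
  · exact Or.inl (h₁ g ⟨hg, hgr⟩)
  · exact Or.inr (h₂ g hg hgr)

/-- A local lift of a chart along a diffeological étale map, restricted to a stable open set on
which it is invariant, is an orbifold chart. -/
theorem IsDiffEtale.isOrbifoldChart_lift {f : X → Y} (hf : IsDiffEtale f)
    {U : Set (EuclideanSpace ℝ (Fin n))} {G : Subgroup (GLn n)} {φ : U → Y}
    (hφ : IsOrbifoldChart U G φ) {W : Set (EuclideanSpace ℝ (Fin n))} (hWU : W ⊆ U)
    (hWo : IsOpen W) (hW : IsStableUnder G W) {L : W → X} (hL : DSmooth L)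
    (hlift : ∀ r, f (L r) = φ (Set.inclusion hWU r))
    (hinv : ∀ g ∈ setStabilizer G W, ∀ r s : W,
      g • (s : EuclideanSpace ℝ (Fin n)) = r → L r = L s) :
    IsOrbifoldChart W (setStabilizer G W) L := by
  have hrel : ∀ r s : W, L r = L s ↔ orbitSetoid W (setStabilizer G W) r s := fun r s ↦ by
    rw [orbitSetoid_apply]
    refine ⟨fun h ↦ ?_, fun ⟨g, hg, hgr⟩ ↦ hinv g hg r s hgr⟩
    obtain ⟨g, hg, hgr⟩ := hφ.apply_eq_iff.1
      ((hlift r).symm.trans ((congrArg f h).trans (hlift s)))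
    refine ⟨g, ⟨hg, (hW.2 g hg).resolve_right fun hd ↦ ?_⟩, hgr⟩
    exact Set.disjoint_left.1 hd ⟨s, s.2, hgr⟩ r.2
  -- Near a parameter sent into `L(W)`, every plot factors smoothly through `L`. This yields both
  -- D-openness of the image and smoothness of the inverse.
  have hloc : ∀ (m : ℕ) (p : EuclideanSpace ℝ (Fin m) → X), IsPlot p → ∀ x, p x ∈ Set.range L →
      ∃ v : Set (EuclideanSpace ℝ (Fin m)), IsOpen v ∧ x ∈ v ∧ ∃ q : v → W, DSmooth q ∧
        ∀ y : v, p y = L (q y) := by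
    rintro m p hp x ⟨w, hw⟩
    have hfp : DSmooth fun y : (Set.univ : Set (EuclideanSpace ℝ (Fin m))) ↦ f (p y) :=
      hf.1.comp (hp.dSmooth.comp (dSmooth_val Set.univ))
    obtain ⟨v, _, hxv, hv, q, hq, hqx, hφq⟩ := hφ.exists_lift isOpen_univ hfp (x := ⟨x, trivial⟩)
      (w := Set.inclusion hWU w) (by rw [← hlift, hw])
    set v₁ : Set (EuclideanSpace ℝ (Fin m)) :=
      Subtype.val '' ((fun y ↦ (q y : EuclideanSpace ℝ (Fin n))) ⁻¹' W) with hv₁_def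
    have hv₁ : IsOpen v₁ :=
      (isDOpen_iff_isOpen.2 hWo).isOpen_image_preimage hv ((dSmooth_val U).comp hq)
    have hv₁v : v₁ ⊆ v := by rintro _ ⟨y, -, rfl⟩; exact y.2
    have hmem : ∀ y : v₁, (q (Set.inclusion hv₁v y) : EuclideanSpace ℝ (Fin n)) ∈ W := by
      rintro ⟨_, y, hy, rfl⟩
      exact hy
    have hxv₁ : x ∈ v₁ := ⟨⟨x, hxv⟩, by rw [Set.mem_preimage, hqx]; exact w.2, rfl⟩
    have hq₁ : DSmooth fun y : v₁ ↦ (⟨q (Set.inclusion hv₁v y), hmem y⟩ : W) :=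
      ((dSmooth_val U).comp (hq.comp (dSmooth_inclusion hv₁v))).codRestrict hmem
    obtain ⟨v₂, hv₂, hxv₂, hv₂v₁, heq⟩ := hf.eventually_eq hv₁
      (hp.dSmooth.comp (dSmooth_val v₁)) (hL.comp hq₁) (fun y ↦ by
        rw [Function.comp_apply, Function.comp_apply, hlift]
        exact (hφq (Set.inclusion hv₁v y)).symm) (x := ⟨x, hxv₁⟩) (by
        rw [Function.comp_apply, Function.comp_apply, ← hw]
        exact congrArg L (Subtype.ext (congrArg Subtype.val hqx).symm))
    exact ⟨v₂, hv₂, hxv₂, _, hq₁.comp (dSmooth_inclusion hv₂v₁),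
      fun y ↦ heq (Set.inclusion hv₂v₁ y) y.2⟩
  refine ⟨hWo, hW.1, ?_, fun g hg r hr ↦ ?_, Set.range L, ?_, ?_⟩
  · have := hφ.finite
    exact Finite.of_injective (Subgroup.inclusion (inf_le_left : setStabilizer G W ≤ G))
      (Subgroup.inclusion_injective _)
  · have hgW : g • W = W := hg.2
    rw [← hgW]
    exact Set.smul_mem_smul_set hr
  · refine isOpen_iff_preimages_plots.2 fun m p hp ↦ isOpen_iff_mem_nhds.2 fun x hx ↦ ?_
    obtain ⟨v, hv, hxv, q, -, hpq⟩ := hloc m p hp x hx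
    exact Filter.mem_of_superset (hv.mem_nhds hxv) fun y hy ↦ ⟨_, (hpq ⟨y, hy⟩).symm⟩
  · have hlm : ∀ r, Set.rangeFactorization L r =
        Quotient.lift (Set.rangeFactorization L)
          (fun r s h ↦ Subtype.ext ((hrel r s).2 h)) (Quotient.mk (orbitSetoid W _) r) :=
      fun _ ↦ rfl
    set Λ : Quotient (orbitSetoid W (setStabilizer G W)) → Set.range L :=
      Quotient.lift (Set.rangeFactorization L) (fun r s h ↦ Subtype.ext ((hrel r s).2 h))
    have hbij : Function.Bijective Λ := by
      constructor
      · intro a b hab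
        obtain ⟨r, rfl⟩ := Quotient.exists_rep a
        obtain ⟨s, rfl⟩ := Quotient.exists_rep b
        exact Quotient.sound ((hrel r s).1 (congrArg Subtype.val hab))
      · rintro ⟨_, r, rfl⟩
        exact ⟨Quotient.mk _ r, rfl⟩
    refine ⟨⟨Equiv.ofBijective Λ hbij, ?_, fun m p hp ↦ isPlot_of_locally fun x ↦ ?_⟩,
      fun r ↦ rfl⟩
    · exact DSmooth.quotientLift (hL.codRestrict _) _
    · obtain ⟨v, hv, hxv, q, hq, hpq⟩ := hloc m (fun y ↦ (p y : X)) hp x (p x).2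
      refine ⟨v, hv, hxv, ?_⟩
      convert (dSmooth_quotientMk (orbitSetoid W (setStabilizer G W))).comp hq using 1
      funext y
      exact (Equiv.symm_apply_eq (Equiv.ofBijective Λ hbij)).2 (Subtype.ext (hpq y))

/-- Local lifts of orbifold charts along a diffeological étale map restrict to orbifold charts. -/
theorem IsLocalLift.exists_isOrbifoldChart {f : X → Y} (hf : IsDiffEtale f)
    {U : Set (EuclideanSpace ℝ (Fin n))} {G : Subgroup (GLn n)} {φ : U → Y}
    (hφ : IsOrbifoldChart U G φ) {r₀ : U} {ξ : X} {V : Set (EuclideanSpace ℝ (Fin n))} {L : V → X}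
    (hL : IsLocalLift f φ r₀ ξ V L) :
    ∃ (W : Set (EuclideanSpace ℝ (Fin n))) (hWV : W ⊆ V),
      (r₀ : EuclideanSpace ℝ (Fin n)) ∈ W ∧ IsOpen W ∧ IsStableUnder G W ∧
      setStabilizer G W = isotropy G r₀ ∧
      IsOrbifoldChart W (setStabilizer G W) (fun r : W ↦ L (Set.inclusion hWV r)) := by
  have := hφ.finite
  have hV := hL.isOpen
  obtain ⟨hr₀V, -⟩ := hL.base
  -- For `g` fixing `r₀`, uniqueness of lifts makes `L ∘ g` and `L` agree on some `N g`; finiteness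
  -- of `G` allows all the `N g` to be intersected.
  have hcoin : ∀ g : G, ∃ N ∈ 𝓝 (r₀ : EuclideanSpace ℝ (Fin n)),
      (g : GLn n) • (r₀ : EuclideanSpace ℝ (Fin n)) = r₀ → ∀ r s : V,
      (s : EuclideanSpace ℝ (Fin n)) ∈ N → (g : GLn n) • (s : EuclideanSpace ℝ (Fin n)) = r →
      L r = L s := by
    intro g
    by_cases hg : (g : GLn n) • (r₀ : EuclideanSpace ℝ (Fin n)) = r₀
    swap
    · exact ⟨Set.univ, Filter.univ_mem, fun h ↦ absurd h hg⟩
    set u : Set (EuclideanSpace ℝ (Fin n)) := V ∩ (fun r ↦ (g : GLn n) • r) ⁻¹' V with hu_def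
    have hu : IsOpen u := hV.inter (hV.preimage (contDiff_GLn_smul _).continuous)
    have huV : u ⊆ V := Set.inter_subset_left
    have hγ : DSmooth fun y : u ↦
        (⟨(g : GLn n) • (y : EuclideanSpace ℝ (Fin n)), y.2.2⟩ : V) :=
      ((contDiff_GLn_smul (g : GLn n)).dSmooth.comp (dSmooth_val u)).codRestrict fun y ↦ y.2.2
    obtain ⟨v, hv, hrv, hvu, heq⟩ := hf.eventually_eq hu (hL.dSmooth.comp hγ)
      (hL.dSmooth.comp (dSmooth_inclusion huV)) (fun y ↦ by
        rw [Function.comp_apply, Function.comp_apply, hL.lift, hL.lift]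
        exact hφ.apply_eq_iff.2 ⟨g, g.2, rfl⟩)
      (x := ⟨r₀, hr₀V, by rw [Set.mem_preimage, hg]; exact hr₀V⟩)
      (congrArg L (Subtype.ext hg))
    refine ⟨v, hv.mem_nhds hrv, fun _ r s hs hsr ↦ ?_⟩
    have hr : r = ⟨(g : GLn n) • (s : EuclideanSpace ℝ (Fin n)), (hvu hs).2⟩ :=
      Subtype.ext hsr.symm
    rw [hr]
    exact heq ⟨s, hvu hs⟩ hs
  choose N hN hNL using hcoin
  obtain ⟨W, hWN, hrW, hWo, hWst, hstab⟩ := exists_stable_neighborhood G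
    (r₀ : EuclideanSpace ℝ (Fin n))
    (Filter.inter_mem (hV.mem_nhds hr₀V) (Filter.iInter_mem.2 hN))
  have hWV : W ⊆ V := fun r hr ↦ (hWN hr).1
  refine ⟨W, hWV, hrW, hWo, hWst, hstab, hf.isOrbifoldChart_lift hφ (hWV.trans hL.subset) hWo hWst
    (hL.dSmooth.comp (dSmooth_inclusion hWV)) (fun r ↦ hL.lift _) fun g hg r s hgs ↦ ?_⟩
  rw [hstab] at hg
  exact hNL ⟨g, hg.1⟩ hg.2 _ (Set.inclusion hWV s) (Set.mem_iInter.1 (hWN s.2).2 _) hgs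

/-- The source of a diffeological étale map to an orbifold is an orbifold. -/
theorem IsDiffEtale.isDiffOrbifold {f : X → Y} (hf : IsDiffEtale f) (hY : IsDiffOrbifold n Y) :
    IsDiffOrbifold n X := by
  intro ξ
  obtain ⟨U, G, φ, hφ, r₀, hr₀⟩ := hY (f ξ)
  obtain ⟨V, L, hL⟩ := hf.exists_isLocalLift hφ.isOpen hφ.dSmooth hr₀
  obtain ⟨W, hWV, hrW, -, -, -, hchart⟩ := hL.exists_isOrbifoldChart hf hφ
  obtain ⟨_, hξ⟩ := hL.base
  exact ⟨W, _, _, hchart, ⟨r₀, hrW⟩, hξ⟩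

end Chart

end Diffeology

theorem theorem5p14 {n : ℕ} {E : Type*} {O : Type*} [DiffeologicalSpace E] [DiffeologicalSpace O]
    (hO : IsDiffOrbifold n O) :
    (∀ π : E → O, IsDiffEtale π →
      IsDiffOrbifold n E ∧
      ∀ (ξ : E) (U : Set (EuclideanSpace ℝ (Fin n))) (G : Subgroup (GLn n)) (φ : U → O),
        IsOrbifoldChart U G φ → ∀ r₀ : U, φ r₀ = π ξ →
          (∃ (V : Set (EuclideanSpace ℝ (Fin n))) (L : V → E), IsLocalLift π φ r₀ ξ V L) ∧
          ∀ (V : Set (EuclideanSpace ℝ (Fin n))) (L : V → E), IsLocalLift π φ r₀ ξ V L →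
            ∃ (W : Set (EuclideanSpace ℝ (Fin n))) (hWV : W ⊆ V),
              (r₀ : EuclideanSpace ℝ (Fin n)) ∈ W ∧ IsOpen W ∧ IsStableUnder G W ∧
              setStabilizer G W = isotropy G r₀ ∧
              IsOrbifoldChart W (setStabilizer G W) (fun r : W ↦ L (Set.inclusion hWV r))) ∧
    (∀ π : E → O, IsDiffCovering π → IsDiffOrbifold n E) := by
  refine ⟨fun π hπ ↦ ⟨hπ.isDiffOrbifold hO, fun ξ U G φ hφ r₀ hr₀ ↦ ⟨?_, fun V L hL ↦ ?_⟩⟩,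
    fun π hπ ↦ hπ.isDiffEtale.isDiffOrbifold hO⟩
  · exact hπ.exists_isLocalLift hφ.isOpen hφ.dSmooth hr₀
  · exact hL.exists_isOrbifoldChart hπ hφ
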